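/- A mixture of two one-dimensional Gaussians is a law $F = p_1 N(\mu_1,\sigma_1^2) + p_2 N(\mu_2,\sigma_2^2)$ with $p_1,p_2\ge 0$, $p_1+p_2=1$, $\mu_i\in\mathbb R$, $\sigma_i^2>0$; its variance is $\mathrm{Var}(F)=p_1p_2(\mu_1-\mu_2)^2+p_1\sigma_1^2+p_2\sigma_2^2$. An algorithm with $n$ samples is a (possibly randomized, computationally unrestricted) procedure, formally a Markov kernel, that maps $(x_1,\dots,x_n)\in\mathbb R^n$ either to an estimate $(\hat\mu_1,\hat\mu_2)\in\mathbb R^2$ of the means or to an estimate $(\hat s_1,\hat s_2)\in\mathbb R^2$ of the variances; it chooses which of the two to return, and says which. In particular, algorithms that always estimate the means and algorithms that always estimate the variances are covered. The returned estimate is $\epsilon$-accurate for a mixture $F$ of variance $\sigma^2$ if, for some permutation $\pi$ of $\{1,2\}$, it is an estimate of the means with $|\mu_i-\hat\mu_{\pi(i)}|\le\epsilon\sigma$ for $i=1,2$, or an estimate of the variances with $|\sigma_i^2-\hat s_{\pi(i)}|\le\epsilon^2\sigma^2$ for $i=1,2$. **Theorem.** There are absolute constants $p_0>0$ and $\epsilon_0>0$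 such that for every $\delta_0\in(0,1/2)$ there is a constant $c>0$, depending only on $\delta_0$, with the following property. Let $\sigma>0$, $0<\epsilon\le\epsilon_0$, $0<\delta\le\delta_0$ and $n\in\mathbb N$, and consider any algorithm (which may depend on $\sigma,\epsilon,\delta,n$) that, for every mixture $F$ of two one-dimensional Gaussians with variance exactly $\sigma^2$ and $p_1,p_2\ge p_0$, when given $n$ independent samples of $F$, returns an $\epsilon$-accurate estimate for $F$ with probability at least $1-\delta$. Then $$n\ \ge\ c\,\epsilon^{-12}\log(1/\delta).$$ Since the class of mixtures on which the algorithm has to succeed is restricted, the same bound holds a fortiori for algorithms that succeed on all mixtures of two Gaussians with variance $\sigma^2$. -/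

import Mathlib

open MeasureTheory ProbabilityTheory
open scoped NNReal ENNReal

noncomputable section

/-- A mixture of two one-dimensional Gaussians: mixing weights, means and (positive)
variances of the two components. -/
structure GaussianMixture where
  weight : Fin 2 → ℝ
  mean : Fin 2 → ℝ
  var : Fin 2 → ℝ≥0
  weight_nonneg : ∀ i, 0 ≤ weight i
  weight_sum : weight 0 + weight 1 = 1
  var_pos : ∀ i, 0 < var i

namespace GaussianMixture

/-- The law of one sample of the mixture. -/
def law (F : GaussianMixture) : Measure ℝ :=
  ∑ i, ENNReal.ofReal (F.weight i) • gaussianReal (F.mean i) (F.var i)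

instance (F : GaussianMixture) : IsProbabilityMeasure F.law := by
  constructor
  simp only [law, Fin.sum_univ_two, Measure.add_apply, Measure.smul_apply, measure_univ,
    smul_eq_mul, mul_one]
  rw [← ENNReal.ofReal_add (F.weight_nonneg 0) (F.weight_nonneg 1), F.weight_sum,
    ENNReal.ofReal_one]

/-- The variance `σ²` of the mixture. -/
def variance (F : GaussianMixture) : ℝ :=
  F.weight 0 * F.weight 1 * (F.mean 0 - F.mean 1) ^ 2
    + F.weight 0 * F.var 0 + F.weight 1 * F.var 1

/-- The law of `n` independent samples of the mixture. -/
def sampleLaw (F : GaussianMixture) (n : ℕ) : Measure (Fin n → ℝ) :=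
  Measure.pi fun _ => F.law

/-- `m` gives both component means up to additive error `r`, up to relabelling. -/
def MeansWithin (F : GaussianMixture) (r : ℝ) (m : Fin 2 → ℝ) : Prop :=
  ∃ π : Equiv.Perm (Fin 2), ∀ i, |F.mean i - m (π i)| ≤ r

/-- `s` gives both component variances up to additive error `r`, up to relabelling. -/
def VarsWithin (F : GaussianMixture) (r : ℝ) (s : Fin 2 → ℝ) : Prop :=
  ∃ π : Equiv.Perm (Fin 2), ∀ i, |(F.var i : ℝ) - s (π i)| ≤ r

end GaussianMixture

/-- What an algorithm returns: either an estimate of the two means (`Sum.inl`), or an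
estimate of the two variances (`Sum.inr`). -/
abbrev Estimate : Type := (Fin 2 → ℝ) ⊕ (Fin 2 → ℝ)

/-- The estimate is accurate for `F`: it is an estimate of the means that is correct to
`± ε σ`, or an estimate of the variances that is correct to `± ε² σ²`, where `σ²` is the
variance of the mixture `F`. -/
def Estimate.Accurate (e : Estimate) (F : GaussianMixture) (ε : ℝ) : Prop :=
  (∃ m, e = Sum.inl m ∧ F.MeansWithin (ε * √F.variance) m) ∨
    (∃ s, e = Sum.inr s ∧ F.VarsWithin (ε ^ 2 * F.variance) s)

/-- The (possibly randomized) algorithm `A`, run on `n` independent samples of `F`, returns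
an accurate estimate with probability at least `1 - δ`. -/
def LearnsEither {n : ℕ} (A : Kernel (Fin n → ℝ) Estimate) (F : GaussianMixture)
    (ε δ : ℝ) : Prop :=
  ENNReal.ofReal (1 - δ) ≤ (F.sampleLaw n).bind A {e | e.Accurate F ε}

end

/-! ### Distinguishing two product laws -/

/-! Two fixed mixtures, `priorA` and `priorB`, have the same moments up to order five, yet one mean
and one variance of the first lie well below both means and both variances of the second. For y
drawn from either, t y + N(0, v) is again a mixture of two Gaussians, with the same weights
(`smooth`). With t²/v = ε² and total variance σ², the parameters of the two smoothings differ by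
more than twice the permitted error. Hence no estimate of either kind is accurate for both, and an
algorithm yields a test between the two.

Such a test needs many samples. Relative to N(0, v), densities coming from two priors have inner
product E exp(w y z), with w = t²/v and y, z independent draws from the priors; for small w this is
a power series in w whose coefficients are products of moments. Agreement up to order five leaves a
squared L² distance O(w⁶) = O(ε¹²), and since the densities are bounded below, the chi-square
divergence χ is O(ε¹²) as well (`exists_chiSq_le`). The second moment of the likelihood ratio of n
samples is at most (1 + χ)^n, while a test with errors δ forces it to be at least 1/(δ(1 - δ)) - 3
(`chiSq_testing`, `log_le_of_tests`). -/

lemma lintegral_pi_prod_eq_prod {ι Ω : Type*} [Fintype ι] {_ : MeasurableSpace Ω}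
    (Q : Measure Ω) [IsProbabilityMeasure Q] (f : ι → Ω → ℝ≥0∞) (hf : ∀ i, Measurable (f i)) :
    ∫⁻ x, ∏ i, f i (x i) ∂Measure.pi (fun _ : ι => Q) = ∏ i, ∫⁻ y, f i y ∂Q := by
  have hind : iIndepFun (fun (i : ι) (x : ι → Ω) => f i (x i)) (Measure.pi fun _ => Q) :=
    iIndepFun_pi fun i => (hf i).aemeasurable
  rw [lintegral_prod_eq_prod_lintegral_of_indepFun Finset.univ _ hind
    fun i => (hf i).comp (measurable_pi_apply i)]
  refine Finset.prod_congr rfl fun i _ => ?_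
  exact (measurePreserving_eval (fun _ : ι => Q) i).lintegral_comp (hf i)

lemma pi_withDensity_eq {ι Ω : Type*} [Fintype ι] {_ : MeasurableSpace Ω}
    (P Q : Measure Ω) [IsProbabilityMeasure P] [IsProbabilityMeasure Q] (r : Ω → ℝ≥0∞)
    (hr : Measurable r) (hP : P = Q.withDensity r) :
    Measure.pi (fun _ : ι => P) =
      (Measure.pi fun _ : ι => Q).withDensity fun x => ∏ i, r (x i) := by
  refine Measure.pi_eq (μ := fun _ : ι => P) fun s hs => ?_
  rw [withDensity_apply _ (MeasurableSet.univ_pi hs),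
    ← lintegral_indicator (MeasurableSet.univ_pi hs)]
  have h : ∀ x : ι → Ω, (Set.univ.pi s).indicator (fun x => ∏ i, r (x i)) x
      = ∏ i, (s i).indicator r (x i) := by
    intro x
    by_cases hx : x ∈ Set.univ.pi s
    · rw [Set.indicator_of_mem hx]
      exact Finset.prod_congr rfl fun i _ =>
        (Set.indicator_of_mem (hx i (Set.mem_univ i)) r).symm
    · rw [Set.indicator_of_notMem hx]
      have hx' : ∃ i, x i ∉ s i := by simpa [Set.mem_pi] using hx
      obtain ⟨i, hi⟩ := hx'
      exact (Finset.prod_eq_zero (Finset.mem_univ i) (Set.indicator_of_notMem hi r)).symm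
  simp_rw [h]
  rw [lintegral_pi_prod_eq_prod Q _ fun i => hr.indicator (hs i)]
  refine Finset.prod_congr rfl fun i _ => ?_
  rw [lintegral_indicator (hs i), hP, withDensity_apply _ (hs i)]

/-- The chi-square bound on the errors of a randomized test `T` between `Q` and `r • Q`. -/
lemma chiSq_testing {Ω : Type*} {_ : MeasurableSpace Ω} (Q : Measure Ω) [IsProbabilityMeasure Q]
    (r T S : Ω → ℝ≥0∞) (hr : Measurable r) (hT : Measurable T) (hS : Measurable S)
    (hTS : ∀ x, T x + S x ≤ 1) (δ : ℝ) (hδ : 0 < δ) (hδ' : δ ≤ 1 / 2)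
    (hrfin : ∀ᵐ x ∂Q, r x ≠ ∞) (h1 : ∫⁻ x, r x ∂Q = 1)
    (hP : ENNReal.ofReal (1 - δ) ≤ ∫⁻ x, r x * T x ∂Q)
    (hQ : ENNReal.ofReal (1 - δ) ≤ ∫⁻ x, S x ∂Q) :
    ENNReal.ofReal (1 / (δ * (1 - δ)) - 3) ≤ ∫⁻ x, r x ^ 2 ∂Q := by
  by_cases hfin : ∫⁻ x, r x ^ 2 ∂Q = ∞
  · simp [hfin]
  have hδ1 : 0 < 1 - δ := by linarith
  have hT1 : ∀ x, T x ≤ 1 := fun x => le_self_add.trans (hTS x)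
  have hTtop : ∀ x, T x ≠ ∞ := fun x => ne_top_of_le_ne_top ENNReal.one_ne_top (hT1 x)
  have hSi : ∀ x, S x ≤ 1 := fun x => le_add_self.trans (hTS x)
  have hStop : ∀ x, S x ≠ ∞ := fun x => ne_top_of_le_ne_top ENNReal.one_ne_top (hSi x)
  have ir : Integrable (fun x => (r x).toReal) Q :=
    integrable_toReal_of_lintegral_ne_top hr.aemeasurable (by simp [h1])
  have ir2 : Integrable (fun x => (r x).toReal ^ 2) Q := by
    have := integrable_toReal_of_lintegral_ne_top (hr.pow_const 2).aemeasurable hfin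
    simpa using this
  have iT : Integrable (fun x => (T x).toReal) Q :=
    integrable_toReal_of_lintegral_ne_top hT.aemeasurable
      (ne_top_of_le_ne_top ENNReal.one_ne_top ((lintegral_mono hT1).trans (by simp)))
  have iS : Integrable (fun x => (S x).toReal) Q :=
    integrable_toReal_of_lintegral_ne_top hS.aemeasurable
      (ne_top_of_le_ne_top ENNReal.one_ne_top ((lintegral_mono hSi).trans (by simp)))
  have hrT : ∫⁻ x, r x * T x ∂Q ≠ ∞ :=
    ne_top_of_le_ne_top (by simp [h1] : ∫⁻ x, r x ∂Q ≠ ∞)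
      (lintegral_mono fun x => mul_le_of_le_one_right' (hT1 x))
  have irT : Integrable (fun x => (r x).toReal * (T x).toReal) Q := by
    simpa using integrable_toReal_of_lintegral_ne_top (hr.mul hT).aemeasurable hrT
  have e1 : ∫ x, (r x).toReal ∂Q = 1 := by
    rw [integral_toReal hr.aemeasurable (hrfin.mono fun x hx => lt_top_iff_ne_top.2 hx), h1]; simp
  have e2 : 1 - δ ≤ ∫ x, (r x).toReal * (T x).toReal ∂Q := by
    have h : ∫ x, (r x * T x).toReal ∂Q = (∫⁻ x, r x * T x ∂Q).toReal :=
      integral_toReal (hr.mul hT).aemeasurable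
        (hrfin.mono fun x hx => ENNReal.mul_lt_top (lt_top_iff_ne_top.2 hx)
          (lt_top_iff_ne_top.2 (hTtop x)))
    simp only [ENNReal.toReal_mul] at h
    rw [h]
    exact (ENNReal.ofReal_le_iff_le_toReal hrT).1 hP
  have e3 : ∫ x, (T x).toReal ∂Q ≤ δ := by
    have h : ∫ x, (S x).toReal ∂Q = (∫⁻ x, S x ∂Q).toReal :=
      integral_toReal hS.aemeasurable (ae_of_all _ fun x => lt_top_iff_ne_top.2 (hStop x))
    have hfinS : ∫⁻ x, S x ∂Q ≠ ∞ :=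
      ne_top_of_le_ne_top ENNReal.one_ne_top ((lintegral_mono hSi).trans (by simp))
    have h' : 1 - δ ≤ ∫ x, (S x).toReal ∂Q := by
      rw [h]; exact (ENNReal.ofReal_le_iff_le_toReal hfinS).1 hQ
    have h'' : ∫ x, (T x).toReal ∂Q ≤ ∫ x, (1 - (S x).toReal) ∂Q := by
      refine integral_mono iT ((integrable_const _).sub iS) fun x => ?_
      have := ENNReal.toReal_mono ENNReal.one_ne_top (hTS x)
      rw [ENNReal.toReal_add (hTtop x) (hStop x), ENNReal.toReal_one] at this
      simp only; linarith
    rw [integral_sub (integrable_const _) iS] at h''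
    simp at h''
    linarith
  have e4 : ∫⁻ x, r x ^ 2 ∂Q = ENNReal.ofReal (∫ x, (r x).toReal ^ 2 ∂Q) := by
    have h : ∫ x, (r x ^ 2).toReal ∂Q = (∫⁻ x, r x ^ 2 ∂Q).toReal :=
      integral_toReal (hr.pow_const 2).aemeasurable
        (hrfin.mono fun x hx => ENNReal.pow_lt_top (lt_top_iff_ne_top.2 hx))
    simp only [ENNReal.toReal_pow] at h
    rw [h, ENNReal.ofReal_toReal hfin]
  rw [e4]
  refine ENNReal.ofReal_le_ofReal ?_
  -- Extremal case: both errors equal δ, and the ratio is `a` where `T = 1` and `b` where `T = 0`.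
  -- Its second moment is exactly 1/(δ(1 - δ)) - 3.
  set a : ℝ := (1 - δ) / δ with ha
  set b : ℝ := δ / (1 - δ) with hb
  have hab : b ≤ a := by
    rw [ha, hb, div_le_div_iff₀ hδ1 hδ]; nlinarith
  have hb0 : 0 ≤ b := by positivity
  -- Expansion of T(r - a)² + (1 - T)(r - b)² ≥ 0; its left side involves only r, T and rT, whose
  -- integrals are controlled.
  have hpt : ∀ x, 2 * (a - b) * ((r x).toReal * (T x).toReal) + 2 * b * (r x).toReal - b ^ 2
      - (a ^ 2 - b ^ 2) * (T x).toReal ≤ (r x).toReal ^ 2 := by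
    intro x
    have t0 : 0 ≤ (T x).toReal := ENNReal.toReal_nonneg
    have t1 : (T x).toReal ≤ 1 := by
      simpa using ENNReal.toReal_mono ENNReal.one_ne_top (hT1 x)
    nlinarith [mul_nonneg t0 (sq_nonneg ((r x).toReal - a)),
      mul_nonneg (sub_nonneg.2 t1) (sq_nonneg ((r x).toReal - b))]
  have j1 : Integrable (fun x => 2 * (a - b) * ((r x).toReal * (T x).toReal)) Q := irT.const_mul _
  have j2 : Integrable (fun x => 2 * b * (r x).toReal) Q := ir.const_mul _
  have j3 : Integrable (fun x => (a ^ 2 - b ^ 2) * (T x).toReal) Q := iT.const_mul _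
  have j4 : Integrable (fun x => 2 * (a - b) * ((r x).toReal * (T x).toReal)
    + 2 * b * (r x).toReal) Q := j1.add j2
  have j5 : Integrable (fun x => 2 * (a - b) * ((r x).toReal * (T x).toReal)
    + 2 * b * (r x).toReal - b ^ 2) Q := j4.sub (integrable_const _)
  have hint := integral_mono (j5.sub j3) ir2 hpt
  simp only [Pi.sub_apply] at hint
  rw [integral_sub j5 j3, integral_sub j4 (integrable_const _), integral_add j1 j2,
    integral_const_mul, integral_const_mul, integral_const_mul, e1] at hint
  simp only [integral_const, probReal_univ, smul_eq_mul, one_mul, mul_one] at hint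
  have hval : 1 / (δ * (1 - δ)) - 3 = 2 * (a - b) * (1 - δ) + 2 * b - b ^ 2
      - (a ^ 2 - b ^ 2) * δ := by
    rw [ha, hb]; field_simp; ring
  rw [hval]
  have m1 := mul_le_mul_of_nonneg_left e2 (by linarith : 0 ≤ 2 * (a - b))
  have m2 := mul_le_mul_of_nonneg_left e3 (by nlinarith : 0 ≤ a ^ 2 - b ^ 2)
  linarith

/-- For δ ≤ 1/16, with s = √(1/δ) ≥ 4, one has s² - 3 ≥ s, so the factor 1/2 works. On [1/16, δ₀]
the right side is at least its value at δ₀, which is positive because δ₀ < 1/2 makes 1/(δ₀(1 - δ₀))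
exceed 4. -/
lemma exists_mul_log_le {δ₀ : ℝ} (h0 : 0 < δ₀) (h1 : δ₀ < 1 / 2) :
    ∃ c : ℝ, 0 < c ∧ ∀ δ : ℝ, 0 < δ → δ ≤ δ₀ →
      c * Real.log (1 / δ) ≤ Real.log (1 / (δ * (1 - δ)) - 3) := by
  set L : ℝ := Real.log (1 / (δ₀ * (1 - δ₀)) - 3) with hL
  have hq : 0 < δ₀ * (1 - δ₀) := by nlinarith
  have hq4 : 4 < 1 / (δ₀ * (1 - δ₀)) := by
    rw [lt_div_iff₀ hq]; nlinarith [sq_pos_of_pos (by linarith : 0 < 1 / 2 - δ₀)]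
  have hLpos : 0 < L := Real.log_pos (by linarith)
  have h16 : 0 < Real.log 16 := Real.log_pos (by norm_num)
  refine ⟨min (1 / 2) (L / Real.log 16), by positivity, fun δ hδ hδ0 => ?_⟩
  have hd : 0 < 1 - δ := by linarith
  have hlog : 0 ≤ Real.log (1 / δ) :=
    Real.log_nonneg (by rw [le_div_iff₀ hδ]; linarith)
  rcases le_total δ (1 / 16) with h | h
  · refine (mul_le_mul_of_nonneg_right (min_le_left _ _) hlog).trans ?_
    have hs : 1 / 2 * Real.log (1 / δ) = Real.log (√(1 / δ)) := by
      rw [Real.log_sqrt (by positivity)]; ring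
    rw [hs]
    have h4 : 4 ≤ √(1 / δ) := by
      refine Real.le_sqrt_of_sq_le ?_
      rw [le_div_iff₀ hδ]; linarith
    refine Real.log_le_log (by linarith) ?_
    have hsq : √(1 / δ) ^ 2 = 1 / δ := Real.sq_sqrt (by positivity)
    have hle : 1 / δ ≤ 1 / (δ * (1 - δ)) := by
      apply one_div_le_one_div_of_le (by positivity); nlinarith
    nlinarith
  · refine (mul_le_mul_of_nonneg_right (min_le_right _ _) hlog).trans ?_
    have hle : Real.log (1 / δ) ≤ Real.log 16 := by
      refine Real.log_le_log (by positivity) ?_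
      rw [div_le_iff₀ hδ]; linarith
    calc L / Real.log 16 * Real.log (1 / δ) ≤ L / Real.log 16 * Real.log 16 := by gcongr
      _ = L := by field_simp
      _ ≤ _ := by
        refine Real.log_le_log (by linarith) ?_
        have : 1 / (δ₀ * (1 - δ₀)) ≤ 1 / (δ * (1 - δ)) := by
          apply one_div_le_one_div_of_le (by positivity); nlinarith
        linarith

/-- Sample size needed to test between product laws with a bounded chi-square divergence. -/
lemma log_le_of_tests {Ω : Type*} {_ : MeasurableSpace Ω} (P Q : Measure Ω)
    [IsProbabilityMeasure P] [IsProbabilityMeasure Q] (r : Ω → ℝ≥0∞) (hr : Measurable r)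
    (hP : P = Q.withDensity r) (hrtop : ∀ x, r x ≠ ∞) (χ : ℝ) (hχ : 0 ≤ χ)
    (hr2 : ∫⁻ x, r x ^ 2 ∂Q ≤ ENNReal.ofReal (1 + χ)) (n : ℕ)
    (T S : (Fin n → Ω) → ℝ≥0∞) (hT : Measurable T) (hS : Measurable S)
    (hTS : ∀ x, T x + S x ≤ 1) (δ : ℝ) (hδ : 0 < δ) (hδ' : δ < 1 / 2)
    (h1 : ENNReal.ofReal (1 - δ) ≤ ∫⁻ x, T x ∂Measure.pi fun _ => P)
    (h2 : ENNReal.ofReal (1 - δ) ≤ ∫⁻ x, S x ∂Measure.pi fun _ => Q) :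
    Real.log (1 / (δ * (1 - δ)) - 3) ≤ n * χ := by
  have hR : Measurable fun x : Fin n → Ω => ∏ i, r (x i) :=
    Finset.measurable_prod _ fun i _ => hr.comp (measurable_pi_apply i)
  have hpi := pi_withDensity_eq (ι := Fin n) P Q r hr hP
  have hint : ∫⁻ x, ∏ i, r (x i) ∂(Measure.pi fun _ : Fin n => Q) = 1 := by
    have := congrArg (fun μ => μ Set.univ) hpi
    simpa [withDensity_apply _ MeasurableSet.univ] using this.symm
  have key := chiSq_testing (Measure.pi fun _ : Fin n => Q) (fun x => ∏ i, r (x i)) T S hR hT hS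
    hTS δ hδ hδ'.le (ae_of_all _ fun x => ENNReal.prod_ne_top fun i _ => hrtop _) hint
    (by rwa [hpi, lintegral_withDensity_eq_lintegral_mul _ hR hT] at h1) h2
  -- Independence turns the second moment of the product ratio into an n-th power.
  simp_rw [← Finset.prod_pow] at key
  rw [lintegral_pi_prod_eq_prod Q (fun _ y => r y ^ 2) fun _ => hr.pow_const 2,
    Finset.prod_const, Finset.card_univ, Fintype.card_fin] at key
  have hle : ENNReal.ofReal (1 / (δ * (1 - δ)) - 3) ≤ ENNReal.ofReal ((1 + χ) ^ n) := by
    rw [ENNReal.ofReal_pow (by linarith)]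
    exact key.trans (by gcongr)
  have hq : 0 < δ * (1 - δ) := by nlinarith
  have hq4 : 4 < 1 / (δ * (1 - δ)) := by
    rw [lt_div_iff₀ hq]; nlinarith [sq_pos_of_pos (by linarith : 0 < 1 / 2 - δ)]
  have hle' : 1 / (δ * (1 - δ)) - 3 ≤ (1 + χ) ^ n :=
    (ENNReal.ofReal_le_ofReal_iff (by positivity)).1 hle
  calc Real.log (1 / (δ * (1 - δ)) - 3) ≤ Real.log ((1 + χ) ^ n) :=
        Real.log_le_log (by linarith) hle'
    _ = n * Real.log (1 + χ) := Real.log_pow _ _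
    _ ≤ n * χ := by
        gcongr
        have := Real.log_le_sub_one_of_pos (by linarith : 0 < 1 + χ)
        linarith

/-! ### Gaussian location mixtures relative to a centred Gaussian -/

/-- The density at `x` of `N(t * y, v)` relative to `N(0, v)`. -/
noncomputable def shiftDensity (v : ℝ≥0) (t x y : ℝ) : ℝ≥0∞ :=
  ENNReal.ofReal (Real.exp ((x * (t * y) - (t * y) ^ 2 / 2) / v))

/-- The density at `x`, relative to `N(0, v)`, of the mixture of `N(t * y, v)` over `y ∼ ν`. -/
noncomputable def priorDensity (v : ℝ≥0) (t : ℝ) (ν : Measure ℝ) (x : ℝ) : ℝ≥0∞ :=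
  ∫⁻ y, shiftDensity v t x y ∂ν

lemma measurable_shiftDensity (v : ℝ≥0) (t : ℝ) :
    Measurable fun p : ℝ × ℝ => shiftDensity v t p.1 p.2 := by
  unfold shiftDensity; fun_prop

lemma measurable_shiftDensity_right (v : ℝ≥0) (t x : ℝ) :
    Measurable fun y => shiftDensity v t x y := by
  unfold shiftDensity; fun_prop

lemma measurable_priorDensity (v : ℝ≥0) (t : ℝ) (ν : Measure ℝ) [SFinite ν] :
    Measurable (priorDensity v t ν) :=
  (measurable_shiftDensity v t).lintegral_prod_right'

lemma gaussianReal_eq_withDensity (u : ℝ) {v : ℝ≥0} (hv : v ≠ 0) :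
    gaussianReal u v = (gaussianReal 0 v).withDensity
      fun x => ENNReal.ofReal (Real.exp ((x * u - u ^ 2 / 2) / v)) := by
  rw [gaussianReal_of_var_ne_zero _ hv, gaussianReal_of_var_ne_zero _ hv,
    ← withDensity_mul _ (measurable_gaussianPDF 0 v) (by fun_prop)]
  congr 1
  ext x
  have hv' : (v : ℝ) ≠ 0 := by exact_mod_cast hv
  simp only [Pi.mul_apply, gaussianPDF, gaussianPDFReal]
  rw [← ENNReal.ofReal_mul (by positivity), mul_assoc _ (Real.exp _), ← Real.exp_add]
  congr 3
  field_simp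
  ring

/-- The left side is the convolution of N(tm, t²τ) with N(0, v). Variance beyond v is absorbed into
the prior, so a single reference measure N(0, v) serves every component. -/
lemma gaussianReal_add_eq_withDensity (t m : ℝ) {v : ℝ≥0} (τ : ℝ≥0) (hv : v ≠ 0) :
    gaussianReal (t * m) (v + .mk (t ^ 2) (sq_nonneg t) * τ)
      = (gaussianReal 0 v).withDensity (priorDensity v t (gaussianReal m τ)) := by
  have hconv : gaussianReal (t * m) (v + .mk (t ^ 2) (sq_nonneg t) * τ)
      = ((gaussianReal m τ).map (t * ·)) ∗ (gaussianReal 0 v) := by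
    rw [gaussianReal_map_const_mul, gaussianReal_conv_gaussianReal, add_zero, add_comm v]
  rw [hconv]
  refine Measure.ext_of_lintegral _ fun f hf => ?_
  rw [Measure.lintegral_conv hf, lintegral_map (by fun_prop) (by fun_prop),
    lintegral_withDensity_eq_lintegral_mul _ (measurable_priorDensity v t _) hf]
  have h1 : ∀ y : ℝ, ∫⁻ x, f (t * y + x) ∂gaussianReal 0 v
      = ∫⁻ x, shiftDensity v t x y * f x ∂gaussianReal 0 v := by
    intro y
    have : ∫⁻ x, f (t * y + x) ∂gaussianReal 0 v = ∫⁻ x, f x ∂gaussianReal (t * y) v := by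
      rw [← zero_add (t * y), ← gaussianReal_map_const_add, lintegral_map hf (by fun_prop), zero_add]
    rw [this, gaussianReal_eq_withDensity _ hv,
      lintegral_withDensity_eq_lintegral_mul _ (by fun_prop) hf]
    rfl
  simp_rw [h1]
  rw [lintegral_lintegral_swap]
  · refine lintegral_congr fun x => ?_
    rw [lintegral_mul_const _ (measurable_shiftDensity_right v t x)]
    rfl
  · exact (((measurable_shiftDensity v t).comp measurable_swap).mul
      (hf.comp measurable_snd)).aemeasurable

/-- Completing the square, the product is exp(t²yz/v) times the density of N(t(y + z), v), which has
mass one. -/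
lemma lintegral_shiftDensity_mul {v : ℝ≥0} (hv : v ≠ 0) (t y z : ℝ) :
    ∫⁻ x, shiftDensity v t x y * shiftDensity v t x z ∂gaussianReal 0 v
      = ENNReal.ofReal (Real.exp (t ^ 2 / v * (y * z))) := by
  have hv' : (v : ℝ) ≠ 0 := by exact_mod_cast hv
  have h : ∀ x, shiftDensity v t x y * shiftDensity v t x z
      = ENNReal.ofReal (Real.exp (t ^ 2 / v * (y * z))) *
        ENNReal.ofReal (Real.exp ((x * (t * (y + z)) - (t * (y + z)) ^ 2 / 2) / v)) := by
    intro x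
    unfold shiftDensity
    rw [← ENNReal.ofReal_mul (by positivity), ← ENNReal.ofReal_mul (by positivity),
      ← Real.exp_add, ← Real.exp_add]
    congr 2
    field_simp
    ring
  simp_rw [h]
  rw [lintegral_const_mul _ (by fun_prop)]
  have h1 := congrArg (fun μ => μ Set.univ) (gaussianReal_eq_withDensity (t * (y + z)) hv)
  simp only [measure_univ, withDensity_apply _ MeasurableSet.univ, Measure.restrict_univ] at h1
  rw [← h1, mul_one]

lemma lintegral_priorDensity_mul {v : ℝ≥0} (hv : v ≠ 0) (t : ℝ) (ν ν' : Measure ℝ)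
    [SFinite ν] [SFinite ν'] :
    ∫⁻ x, priorDensity v t ν x * priorDensity v t ν' x ∂gaussianReal 0 v
      = ∫⁻ p, ENNReal.ofReal (Real.exp (t ^ 2 / v * (p.1 * p.2))) ∂ν.prod ν' := by
  have hm : Measurable fun q : ℝ × ℝ × ℝ =>
      shiftDensity v t q.1 q.2.1 * shiftDensity v t q.1 q.2.2 := by
    unfold shiftDensity; fun_prop
  have h : ∀ x, priorDensity v t ν x * priorDensity v t ν' x
      = ∫⁻ p, shiftDensity v t x p.1 * shiftDensity v t x p.2 ∂ν.prod ν' := by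
    intro x
    rw [lintegral_prod_mul (measurable_shiftDensity_right v t x).aemeasurable
      (measurable_shiftDensity_right v t x).aemeasurable]
    rfl
  simp_rw [h]
  rw [lintegral_lintegral_swap (f := fun x (p : ℝ × ℝ) =>
    shiftDensity v t x p.1 * shiftDensity v t x p.2) hm.aemeasurable]
  exact lintegral_congr fun p => lintegral_shiftDensity_mul hv t p.1 p.2

lemma priorDensity_lt_top {v : ℝ≥0} (hv : v ≠ 0) (t x : ℝ) (ν : Measure ℝ) [IsFiniteMeasure ν] :
    priorDensity v t ν x < ∞ := by
  have hv' : (0 : ℝ) < v := by exact_mod_cast pos_iff_ne_zero.2 hv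
  calc priorDensity v t ν x ≤ ∫⁻ _, ENNReal.ofReal (Real.exp (x ^ 2 / 2 / v)) ∂ν := by
        refine lintegral_mono fun y => ENNReal.ofReal_le_ofReal (Real.exp_le_exp.2 ?_)
        gcongr
        nlinarith [sq_nonneg (x - t * y)]
    _ < ∞ := by
        rw [lintegral_const]
        exact ENNReal.mul_lt_top ENNReal.ofReal_lt_top (measure_lt_top _ _)

/-- Mass near `0` on both sides bounds the density from below. -/
lemma le_priorDensity {v : ℝ≥0} (hv : v ≠ 0) (t x : ℝ) (ν : Measure ℝ) (κ : ℝ≥0∞)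
    (ht : t ^ 2 ≤ v) (h1 : κ ≤ ν (Set.Icc 0 1)) (h2 : κ ≤ ν (Set.Icc (-1) 0)) :
    ENNReal.ofReal (Real.exp (-1)) * κ ≤ priorDensity v t ν x := by
  have hv' : (0 : ℝ) < v := by exact_mod_cast pos_iff_ne_zero.2 hv
  have key : ∀ s : Set ℝ, MeasurableSet s → (∀ y ∈ s, 0 ≤ x * t * y ∧ y ^ 2 ≤ 1) → κ ≤ ν s →
      ENNReal.ofReal (Real.exp (-1)) * κ ≤ priorDensity v t ν x := by
    intro s hs hy hκ
    calc ENNReal.ofReal (Real.exp (-1)) * κ ≤ ENNReal.ofReal (Real.exp (-1)) * ν s := by gcongr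
      _ = ∫⁻ _ in s, ENNReal.ofReal (Real.exp (-1)) ∂ν := by rw [setLIntegral_const]
      _ ≤ ∫⁻ y in s, shiftDensity v t x y ∂ν := by
        refine setLIntegral_mono' hs fun y hys => ?_
        refine ENNReal.ofReal_le_ofReal (Real.exp_le_exp.2 ?_)
        obtain ⟨a, b⟩ := hy y hys
        rw [le_div_iff₀ hv']
        have : (t * y) ^ 2 ≤ v := by
          rw [mul_pow]; nlinarith [sq_nonneg t, sq_nonneg y]
        nlinarith
      _ ≤ _ := setLIntegral_le_lintegral _ _
  -- The half-interval is chosen so that x t y ≥ 0; only -(t y)²/(2v) ≥ -1 is then left in the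
  -- exponent.
  rcases le_total 0 (x * t) with h | h
  · exact key _ measurableSet_Icc (fun y hy => ⟨mul_nonneg h hy.1, by nlinarith [hy.1, hy.2]⟩) h1
  · exact key _ measurableSet_Icc
      (fun y hy => ⟨mul_nonneg_of_nonpos_of_nonpos h hy.2, by nlinarith [hy.1, hy.2]⟩) h2

/-! ### Matching moments -/

/-- With u = w y z, the Taylor remainder is at most |u|ⁿ exp|u|. Writing |u| = (w/w₀) a extracts
(w/w₀)ⁿ; then aⁿ ≤ n! exp a and 2|y||z| ≤ y² + z² separate the variables, leaving
Gaussian-integrable factors. -/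
lemma abs_exp_mul_sub_sum_le {w w₀ : ℝ} (hw : 0 ≤ w) (hw₀ : 0 < w₀) (hle : w ≤ w₀) (y z : ℝ)
    (n : ℕ) :
    |Real.exp (w * (y * z)) - ∑ k ∈ Finset.range n, w ^ k / k.factorial * (y ^ k * z ^ k)|
      ≤ n.factorial * (w / w₀) ^ n * (Real.exp (w₀ * y ^ 2) * Real.exp (w₀ * z ^ 2)) := by
  set a : ℝ := w₀ * (|y| * |z|) with ha
  have ha0 : 0 ≤ a := by positivity
  have h1 := Complex.norm_exp_sub_sum_le_norm_mul_exp ((w * (y * z) : ℝ) : ℂ) n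
  have h2 : Complex.exp ((w * (y * z) : ℝ) : ℂ)
      - ∑ m ∈ Finset.range n, ((w * (y * z) : ℝ) : ℂ) ^ m / (m.factorial : ℂ)
      = ((Real.exp (w * (y * z))
        - ∑ k ∈ Finset.range n, w ^ k / k.factorial * (y ^ k * z ^ k) : ℝ) : ℂ) := by
    push_cast
    congr 1
    refine Finset.sum_congr rfl fun k _ => ?_
    rw [mul_pow, mul_pow]; ring
  rw [h2, Complex.norm_real, Complex.norm_real, Real.norm_eq_abs, Real.norm_eq_abs] at h1
  have h3 : |w * (y * z)| = w / w₀ * a := by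
    rw [abs_mul, abs_mul, abs_of_nonneg hw, ha]; field_simp
  have hq : w / w₀ ≤ 1 := (div_le_one hw₀).2 hle
  have hq0 : 0 ≤ w / w₀ := by positivity
  calc _ ≤ _ := h1
    _ = (w / w₀) ^ n * (a ^ n * Real.exp (w / w₀ * a)) := by rw [h3, mul_pow]; ring
    _ ≤ (w / w₀) ^ n * ((n.factorial * Real.exp a) * Real.exp a) := by
        have h4 := Real.pow_div_factorial_le_exp a ha0 n
        rw [div_le_iff₀ (by positivity)] at h4
        gcongr
        · linarith
        · nlinarith
    _ = n.factorial * (w / w₀) ^ n * Real.exp (2 * a) := by rw [two_mul, Real.exp_add]; ring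
    _ ≤ n.factorial * (w / w₀) ^ n * (Real.exp (w₀ * y ^ 2) * Real.exp (w₀ * z ^ 2)) := by
        rw [← Real.exp_add]
        gcongr
        rw [ha, ← sq_abs y, ← sq_abs z]
        nlinarith [mul_nonneg hw₀.le (sq_nonneg (|y| - |z|))]

lemma integrable_exp_mul_prod {w w₀ A : ℝ} (hw : 0 ≤ w) (hw₀ : 0 < w₀) (hle : w ≤ w₀)
    (ν ν' : Measure ℝ) [IsProbabilityMeasure ν] [IsProbabilityMeasure ν']
    (hν : Integrable (fun y => Real.exp (w₀ * y ^ 2)) ν)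
    (hν' : Integrable (fun y => Real.exp (w₀ * y ^ 2)) ν')
    (hA : ∫ y, Real.exp (w₀ * y ^ 2) ∂ν ≤ A) (hA' : ∫ y, Real.exp (w₀ * y ^ 2) ∂ν' ≤ A)
    (n : ℕ) (hmν : ∀ k < n, Integrable (fun y => y ^ k) ν)
    (hmν' : ∀ k < n, Integrable (fun y => y ^ k) ν') :
    Integrable (fun p : ℝ × ℝ => Real.exp (w * (p.1 * p.2))) (ν.prod ν') ∧
      |∫ p, Real.exp (w * (p.1 * p.2)) ∂ν.prod ν'
        - ∑ k ∈ Finset.range n, w ^ k / k.factorial * ((∫ y, y ^ k ∂ν) * ∫ y, y ^ k ∂ν')|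
      ≤ n.factorial * (w / w₀) ^ n * A ^ 2 := by
  have iE : Integrable (fun p : ℝ × ℝ => Real.exp (w₀ * p.1 ^ 2) * Real.exp (w₀ * p.2 ^ 2))
      (ν.prod ν') := hν.mul_prod hν'
  have iI : Integrable (fun p : ℝ × ℝ => Real.exp (w * (p.1 * p.2))) (ν.prod ν') := by
    refine iE.mono' (by fun_prop) (ae_of_all _ fun p => ?_)
    rw [Real.norm_eq_abs, abs_of_pos (Real.exp_pos _), ← Real.exp_add, Real.exp_le_exp]
    have : w * (p.1 * p.2) ≤ w * ((p.1 ^ 2 + p.2 ^ 2) / 2) :=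
      mul_le_mul_of_nonneg_left (by nlinarith [sq_nonneg (p.1 - p.2)]) hw
    nlinarith [sq_nonneg p.1, sq_nonneg p.2]
  have iM : ∀ k ∈ Finset.range n,
      Integrable (fun p : ℝ × ℝ => w ^ k / k.factorial * (p.1 ^ k * p.2 ^ k)) (ν.prod ν') :=
    fun k hk => ((hmν k (Finset.mem_range.1 hk)).mul_prod
      (hmν' k (Finset.mem_range.1 hk))).const_mul _
  refine ⟨iI, ?_⟩
  have hsum : ∑ k ∈ Finset.range n, w ^ k / k.factorial * ((∫ y, y ^ k ∂ν) * ∫ y, y ^ k ∂ν')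
      = ∫ p, ∑ k ∈ Finset.range n, w ^ k / k.factorial * (p.1 ^ k * p.2 ^ k) ∂ν.prod ν' := by
    rw [integral_finsetSum _ iM]
    refine Finset.sum_congr rfl fun k _ => ?_
    rw [integral_const_mul, ← integral_prod_mul (fun y : ℝ => y ^ k) (fun y : ℝ => y ^ k)]
  rw [hsum, ← integral_sub iI (integrable_finsetSum _ iM)]
  calc _ ≤ ∫ p, |Real.exp (w * (p.1 * p.2))
          - ∑ k ∈ Finset.range n, w ^ k / k.factorial * (p.1 ^ k * p.2 ^ k)| ∂ν.prod ν' :=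
        abs_integral_le_integral_abs
    _ ≤ ∫ p, n.factorial * (w / w₀) ^ n *
          (Real.exp (w₀ * p.1 ^ 2) * Real.exp (w₀ * p.2 ^ 2)) ∂ν.prod ν' :=
        integral_mono (iI.sub (integrable_finsetSum _ iM)).abs (iE.const_mul _) fun p =>
          abs_exp_mul_sub_sum_le hw hw₀ hle p.1 p.2 n
    _ = n.factorial * (w / w₀) ^ n *
          ((∫ y, Real.exp (w₀ * y ^ 2) ∂ν) * ∫ y, Real.exp (w₀ * y ^ 2) ∂ν') := by
        rw [integral_const_mul, integral_prod_mul (fun y : ℝ => Real.exp (w₀ * y ^ 2))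
          (fun y : ℝ => Real.exp (w₀ * y ^ 2))]
    _ ≤ _ := by
        rw [sq]
        have h0 : 0 ≤ ∫ y, Real.exp (w₀ * y ^ 2) ∂ν := integral_nonneg fun y => (Real.exp_pos _).le
        have h0' : 0 ≤ ∫ y, Real.exp (w₀ * y ^ 2) ∂ν' :=
          integral_nonneg fun y => (Real.exp_pos _).le
        gcongr
        exact h0.trans hA

/-- Priors with `n` matching moments give densities that are close in `L²`. -/
lemma lintegral_priorDensity_sq_le {v : ℝ≥0} (hv : v ≠ 0) (t : ℝ) {w₀ A : ℝ} (hw₀ : 0 < w₀)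
    (hle : t ^ 2 / v ≤ w₀)
    (ν ν' : Measure ℝ) [IsProbabilityMeasure ν] [IsProbabilityMeasure ν']
    (hν : Integrable (fun y => Real.exp (w₀ * y ^ 2)) ν)
    (hν' : Integrable (fun y => Real.exp (w₀ * y ^ 2)) ν')
    (hA : ∫ y, Real.exp (w₀ * y ^ 2) ∂ν ≤ A) (hA' : ∫ y, Real.exp (w₀ * y ^ 2) ∂ν' ≤ A)
    (n : ℕ) (hmν : ∀ k < n, Integrable (fun y => y ^ k) ν)
    (hmν' : ∀ k < n, Integrable (fun y => y ^ k) ν')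
    (hm : ∀ k < n, ∫ y, y ^ k ∂ν = ∫ y, y ^ k ∂ν') :
    ∫⁻ x, priorDensity v t ν x ^ 2 ∂gaussianReal 0 v
        + ∫⁻ x, priorDensity v t ν' x ^ 2 ∂gaussianReal 0 v
      ≤ 2 * ∫⁻ x, priorDensity v t ν x * priorDensity v t ν' x ∂gaussianReal 0 v
        + ENNReal.ofReal (4 * (n.factorial * (t ^ 2 / v / w₀) ^ n * A ^ 2)) := by
  have hw : 0 ≤ t ^ 2 / (v : ℝ) := by positivity
  set w : ℝ := t ^ 2 / v with hwdef
  obtain ⟨i1, b1⟩ := integrable_exp_mul_prod hw hw₀ hle ν ν hν hν hA hA n hmν hmν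
  obtain ⟨i2, b2⟩ := integrable_exp_mul_prod hw hw₀ hle ν' ν' hν' hν' hA' hA' n hmν' hmν'
  obtain ⟨i3, b3⟩ := integrable_exp_mul_prod hw hw₀ hle ν ν' hν hν' hA hA' n hmν hmν'
  have c2 : ∑ k ∈ Finset.range n, w ^ k / k.factorial * ((∫ y, y ^ k ∂ν') * ∫ y, y ^ k ∂ν')
      = ∑ k ∈ Finset.range n, w ^ k / k.factorial * ((∫ y, y ^ k ∂ν) * ∫ y, y ^ k ∂ν) :=
    Finset.sum_congr rfl fun k hk => by rw [hm k (Finset.mem_range.1 hk)]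
  have c3 : ∑ k ∈ Finset.range n, w ^ k / k.factorial * ((∫ y, y ^ k ∂ν) * ∫ y, y ^ k ∂ν')
      = ∑ k ∈ Finset.range n, w ^ k / k.factorial * ((∫ y, y ^ k ∂ν) * ∫ y, y ^ k ∂ν) :=
    Finset.sum_congr rfl fun k hk => by rw [hm k (Finset.mem_range.1 hk)]
  rw [c2] at b2
  rw [c3] at b3
  simp_rw [pow_two (priorDensity v t _ _)]
  have e0 : ∀ (μ₁ μ₂ : Measure ℝ) [IsProbabilityMeasure μ₁] [IsProbabilityMeasure μ₂],
      0 ≤ ∫ p, Real.exp (w * (p.1 * p.2)) ∂μ₁.prod μ₂ := fun μ₁ μ₂ _ _ =>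
    integral_nonneg fun p => (Real.exp_pos _).le
  rw [lintegral_priorDensity_mul hv, lintegral_priorDensity_mul hv, lintegral_priorDensity_mul hv,
    ← ofReal_integral_eq_lintegral_ofReal i1 (ae_of_all _ fun p => (Real.exp_pos _).le),
    ← ofReal_integral_eq_lintegral_ofReal i2 (ae_of_all _ fun p => (Real.exp_pos _).le),
    ← ofReal_integral_eq_lintegral_ofReal i3 (ae_of_all _ fun p => (Real.exp_pos _).le),
    ← ENNReal.ofReal_add (e0 ν ν) (e0 ν' ν'),
    show (2 : ℝ≥0∞) = ENNReal.ofReal 2 by simp, ← ENNReal.ofReal_mul (by norm_num),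
    ← ENNReal.ofReal_add (mul_nonneg (by norm_num) (e0 ν ν')) (by positivity)]
  refine ENNReal.ofReal_le_ofReal ?_
  rw [abs_le] at b1 b2 b3
  -- The three truncated series coincide. The factor 4 counts the Taylor errors: one from each
  -- square and two from the cross term.
  linarith [b1.2, b2.2, b3.1]

/-- Second moment of the likelihood ratio of densities that are close in `L²`. -/
lemma lintegral_ratio_sq_le {Ω : Type*} {_ : MeasurableSpace Ω} (γ : Measure Ω)
    (f g : Ω → ℝ≥0∞) (hf : Measurable f) (hg : Measurable g)
    (hft : ∀ x, f x ≠ ∞) (hgt : ∀ x, g x ≠ ∞) (κ D : ℝ) (hκ : 0 < κ) (hD : 0 ≤ D)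
    (hgκ : ∀ x, ENNReal.ofReal κ ≤ g x)
    (hf1 : ∫⁻ x, f x ∂γ = 1) (hg1 : ∫⁻ x, g x ∂γ = 1) (hfg : ∫⁻ x, f x * g x ∂γ ≠ ∞)
    (hclose : ∫⁻ x, f x ^ 2 ∂γ + ∫⁻ x, g x ^ 2 ∂γ
      ≤ 2 * ∫⁻ x, f x * g x ∂γ + ENNReal.ofReal D) :
    ∫⁻ x, (f x / g x) ^ 2 ∂γ.withDensity g ≤ ENNReal.ofReal (1 + D / κ) := by
  have hg0 : ∀ x, 0 < (g x).toReal := fun x =>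
    hκ.trans_le ((ENNReal.ofReal_le_iff_le_toReal (hgt x)).1 (hgκ x))
  set c : ℝ≥0∞ := ENNReal.ofReal (1 / κ) with hc
  -- Subtraction-free form of g(f/g)² = 2f - g + (f - g)²/g ≤ 2f - g + (f - g)²/κ.
  have hpt : ∀ x, g x * (f x / g x) ^ 2 + (g x + 2 * c * (f x * g x))
      ≤ 2 * f x + c * (f x ^ 2 + g x ^ 2) := by
    intro x
    have ha : 0 ≤ (f x).toReal := ENNReal.toReal_nonneg
    have hb := hg0 x
    have hbκ := (ENNReal.ofReal_le_iff_le_toReal (hgt x)).1 (hgκ x)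
    rw [← ENNReal.ofReal_toReal (hft x), ← ENNReal.ofReal_toReal (hgt x)]
    set a := (f x).toReal
    set b := (g x).toReal
    rw [hc, show (2 : ℝ≥0∞) = ENNReal.ofReal 2 by simp, ← ENNReal.ofReal_div_of_pos hb,
      ← ENNReal.ofReal_pow (by positivity), ← ENNReal.ofReal_pow (by positivity),
      ← ENNReal.ofReal_pow (by positivity), ← ENNReal.ofReal_mul (by positivity),
      ← ENNReal.ofReal_mul (by positivity), ← ENNReal.ofReal_mul (by positivity),
      ← ENNReal.ofReal_mul (by positivity), ← ENNReal.ofReal_mul (by positivity),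
      ← ENNReal.ofReal_add (by positivity) (by positivity),
      ← ENNReal.ofReal_add (by positivity) (by positivity),
      ← ENNReal.ofReal_add (by positivity) (by positivity),
      ← ENNReal.ofReal_mul (by positivity),
      ← ENNReal.ofReal_add (by positivity) (by positivity)]
    refine ENNReal.ofReal_le_ofReal ?_
    have h1 : b * (a / b) ^ 2 = 2 * a - b + (a - b) ^ 2 / b := by field_simp; ring
    have h2 : (a - b) ^ 2 / b ≤ (a - b) ^ 2 / κ := by gcongr
    have h3 : (a - b) ^ 2 / κ = 1 / κ * (a ^ 2 + b ^ 2) - 2 * (1 / κ) * (a * b) := by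
      field_simp; ring
    linarith
  have hR : Measurable fun x => (f x / g x) ^ 2 := (hf.div hg).pow_const 2
  rw [lintegral_withDensity_eq_lintegral_mul _ hg hR]
  simp only [Pi.mul_apply]
  have hint := lintegral_mono (μ := γ) hpt
  rw [lintegral_add_left (f := fun x => g x * (f x / g x) ^ 2) (hg.mul hR), lintegral_add_left hg,
    lintegral_const_mul (f := fun x => f x * g x) _ (hf.mul hg),
    lintegral_add_left (hf.const_mul _), lintegral_const_mul _ hf,
    lintegral_const_mul (f := fun x => f x ^ 2 + g x ^ 2) _
      ((hf.pow_const 2).add (hg.pow_const 2)), lintegral_add_left (hf.pow_const 2), hf1, hg1] at hint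
  have hint2 := hint.trans (add_le_add_right (mul_le_mul_right hclose c) (2 * 1))
  have hfin : 1 + 2 * c * ∫⁻ x, f x * g x ∂γ ≠ ∞ :=
    ENNReal.add_ne_top.2 ⟨ENNReal.one_ne_top,
      ENNReal.mul_ne_top (ENNReal.mul_ne_top (by simp) ENNReal.ofReal_ne_top) hfg⟩
  rw [← ENNReal.add_le_add_iff_right hfin]
  refine hint2.trans (le_of_eq ?_)
  rw [ENNReal.ofReal_add (by norm_num) (by positivity), ENNReal.ofReal_one,
    show D / κ = 1 / κ * D by ring, ENNReal.ofReal_mul (by positivity), ← hc]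
  ring

/-! ### Moments of Gaussians -/

lemma gaussianReal_moments (m : ℝ) (τ : ℝ≥0) :
    ∫ y, y ^ 1 ∂gaussianReal m τ = m ∧
    ∫ y, y ^ 2 ∂gaussianReal m τ = m ^ 2 + τ ∧
    ∫ y, y ^ 3 ∂gaussianReal m τ = m ^ 3 + 3 * τ * m ∧
    ∫ y, y ^ 4 ∂gaussianReal m τ = m ^ 4 + 6 * τ * m ^ 2 + 3 * τ ^ 2 ∧
    ∫ y, y ^ 5 ∂gaussianReal m τ = m ^ 5 + 10 * τ * m ^ 3 + 15 * τ ^ 2 * m := by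
  have h0 : (0 : ℝ) ∈ interior (integrableExpSet id (gaussianReal m τ)) := by simp
  have hk : ∀ k, ∫ y, y ^ k ∂gaussianReal m τ
      = iteratedDeriv k (fun t => Real.exp (m * t + τ * t ^ 2 / 2)) 0 := by
    intro k
    rw [← mgf_id_gaussianReal, iteratedDeriv_mgf_zero h0]
    rfl
  -- Each derivative of the moment generating function is a polynomial in m + τt times the same
  -- exponential; at t = 0 the polynomial is the moment.
  have step : ∀ (p p' : ℝ → ℝ), (∀ t, HasDerivAt p (p' t) t) →
      deriv (fun t => p t * Real.exp (m * t + τ * t ^ 2 / 2))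
        = fun t => (p' t + p t * (m + τ * t)) * Real.exp (m * t + τ * t ^ 2 / 2) := by
    intro p p' hp
    ext t
    have he : HasDerivAt (fun t : ℝ => m * t + τ * t ^ 2 / 2) (m + τ * t) t := by
      have := ((hasDerivAt_id t).const_mul m).add
        ((((hasDerivAt_id t).pow 2).const_mul (τ : ℝ)).div_const 2)
      refine this.congr_deriv ?_
      simp; ring
    refine (((hp t).mul he.exp).congr_deriv ?_).deriv
    ring
  have hs : ∀ t, HasDerivAt (fun t : ℝ => m + τ * t) (τ : ℝ) t := fun t => by
    simpa using ((hasDerivAt_id t).const_mul (τ : ℝ)).const_add m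
  have e1 : iteratedDeriv 1 (fun t : ℝ => Real.exp (m * t + τ * t ^ 2 / 2))
      = fun t => (m + τ * t) * Real.exp (m * t + τ * t ^ 2 / 2) := by
    rw [iteratedDeriv_one]
    have := step (fun _ => 1) (fun _ => 0) fun t => hasDerivAt_const t 1
    simpa using this
  have e2 : iteratedDeriv 2 (fun t : ℝ => Real.exp (m * t + τ * t ^ 2 / 2))
      = fun t => ((m + τ * t) ^ 2 + τ) * Real.exp (m * t + τ * t ^ 2 / 2) := by
    rw [iteratedDeriv_succ, e1, step _ _ hs]
    ext t; ring
  have e3 : iteratedDeriv 3 (fun t : ℝ => Real.exp (m * t + τ * t ^ 2 / 2))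
      = fun t => ((m + τ * t) ^ 3 + 3 * τ * (m + τ * t)) * Real.exp (m * t + τ * t ^ 2 / 2) := by
    rw [iteratedDeriv_succ, e2,
      step (fun t => (m + τ * t) ^ 2 + τ) _ fun t => ((hs t).pow 2).add_const (τ : ℝ)]
    ext t; push_cast; ring
  have e4 : iteratedDeriv 4 (fun t : ℝ => Real.exp (m * t + τ * t ^ 2 / 2))
      = fun t => ((m + τ * t) ^ 4 + 6 * τ * (m + τ * t) ^ 2 + 3 * τ ^ 2)
        * Real.exp (m * t + τ * t ^ 2 / 2) := by
    rw [iteratedDeriv_succ, e3,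
      step (fun t => (m + τ * t) ^ 3 + 3 * τ * (m + τ * t)) _
        fun t => ((hs t).pow 3).add ((hs t).const_mul (3 * (τ : ℝ)))]
    ext t; push_cast; ring
  have e5 : iteratedDeriv 5 (fun t : ℝ => Real.exp (m * t + τ * t ^ 2 / 2))
      = fun t => ((m + τ * t) ^ 5 + 10 * τ * (m + τ * t) ^ 3 + 15 * τ ^ 2 * (m + τ * t))
        * Real.exp (m * t + τ * t ^ 2 / 2) := by
    rw [iteratedDeriv_succ, e4,
      step (fun t => (m + τ * t) ^ 4 + 6 * τ * (m + τ * t) ^ 2 + 3 * τ ^ 2) _ fun t => (((hs t).pow 4).add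
      (((hs t).pow 2).const_mul (6 * (τ : ℝ)))).add_const (3 * (τ : ℝ) ^ 2)]
    ext t; push_cast; ring
  refine ⟨?_, ?_, ?_, ?_, ?_⟩
  · rw [hk, e1]; simp
  · rw [hk, e2]; simp
  · rw [hk, e3]; simp
  · rw [hk, e4]; simp
  · rw [hk, e5]; simp

lemma integrable_pow_gaussianReal (m : ℝ) (τ : ℝ≥0) (k : ℕ) :
    Integrable (fun y => y ^ k) (gaussianReal m τ) := by
  have := (memLp_id_gaussianReal (μ := m) (v := τ) (k : ℝ≥0)).integrable_norm_pow'
  refine this.mono' (by fun_prop) (ae_of_all _ fun y => ?_)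
  simp

namespace GaussianMixture

/-! ### Integration against mixtures -/

lemma law_eq (G : GaussianMixture) :
    G.law = ENNReal.ofReal (G.weight 0) • gaussianReal (G.mean 0) (G.var 0)
      + ENNReal.ofReal (G.weight 1) • gaussianReal (G.mean 1) (G.var 1) := by
  rw [law, Fin.sum_univ_two]

lemma integrable_law (G : GaussianMixture) {f : ℝ → ℝ}
    (hf : ∀ i, Integrable f (gaussianReal (G.mean i) (G.var i))) : Integrable f G.law := by
  rw [law_eq]
  exact ((hf 0).smul_measure ENNReal.ofReal_ne_top).add_measure
    ((hf 1).smul_measure ENNReal.ofReal_ne_top)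

lemma integral_law (G : GaussianMixture) {f : ℝ → ℝ}
    (hf : ∀ i, Integrable f (gaussianReal (G.mean i) (G.var i))) :
    ∫ y, f y ∂G.law = G.weight 0 * ∫ y, f y ∂gaussianReal (G.mean 0) (G.var 0)
      + G.weight 1 * ∫ y, f y ∂gaussianReal (G.mean 1) (G.var 1) := by
  rw [law_eq, integral_add_measure ((hf 0).smul_measure ENNReal.ofReal_ne_top)
    ((hf 1).smul_measure ENNReal.ofReal_ne_top), integral_smul_measure, integral_smul_measure,
    ENNReal.toReal_ofReal (G.weight_nonneg 0), ENNReal.toReal_ofReal (G.weight_nonneg 1)]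
  rfl

lemma integrable_pow_law (G : GaussianMixture) (k : ℕ) : Integrable (fun y => y ^ k) G.law :=
  G.integrable_law fun _ => integrable_pow_gaussianReal _ _ k

/-- Fernique's theorem for each component. Allowing every smaller exponent lets two mixtures share
one. -/
lemma exists_integrable_exp_sq_law (G : GaussianMixture) :
    ∃ C : ℝ, 0 < C ∧ ∀ c ≤ C, Integrable (fun y => Real.exp (c * y ^ 2)) G.law := by
  choose C hC hint using fun i : Fin 2 =>
    IsGaussian.exists_integrable_exp_sq (gaussianReal (G.mean i) (G.var i))
  refine ⟨min (C 0) (C 1), lt_min (hC 0) (hC 1), fun c hc => G.integrable_law fun i => ?_⟩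
  refine (hint i).mono' (by fun_prop) (ae_of_all _ fun y => ?_)
  rw [Real.norm_eq_abs, abs_of_pos (Real.exp_pos _), Real.norm_eq_abs, sq_abs, Real.exp_le_exp]
  have : c ≤ C i := by
    fin_cases i
    · exact hc.trans (min_le_left _ _)
    · exact hc.trans (min_le_right _ _)
  gcongr

lemma law_Icc_pos (G : GaussianMixture) {a b : ℝ} (hab : a < b) : 0 < G.law (Set.Icc a b) := by
  have hpos : ∀ i, 0 < gaussianReal (G.mean i) (G.var i) (Set.Icc a b) := by
    intro i
    rw [pos_iff_ne_zero]
    intro h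
    have := gaussianReal_absolutelyContinuous' (G.mean i) (G.var_pos i).ne' h
    rw [Real.volume_Icc, ENNReal.ofReal_eq_zero] at this
    linarith
  rw [law_eq, Measure.add_apply, Measure.smul_apply, Measure.smul_apply, smul_eq_mul, smul_eq_mul]
  have h0 := G.weight_nonneg 0
  have h1 := G.weight_sum
  rcases h0.eq_or_lt with h | h
  · have h' : 0 < G.weight 1 := by linarith
    exact lt_of_lt_of_le (ENNReal.mul_pos (ENNReal.ofReal_pos.2 h').ne' (hpos 1).ne') le_add_self
  · exact lt_of_lt_of_le (ENNReal.mul_pos (ENNReal.ofReal_pos.2 h).ne' (hpos 0).ne') le_self_add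

/-! ### Smoothed mixtures and their chi-square divergence -/

/-- The mixture whose law is that of `t * y + N(0, v)`, where `y` is drawn from `G`. -/
noncomputable def smooth (G : GaussianMixture) (v : ℝ≥0) (hv : 0 < v) (t : ℝ) :
    GaussianMixture where
  weight := G.weight
  mean i := t * G.mean i
  var i := v + .mk (t ^ 2) (sq_nonneg t) * G.var i
  weight_nonneg := G.weight_nonneg
  weight_sum := G.weight_sum
  var_pos _ := add_pos_of_pos_of_nonneg hv zero_le

lemma law_smooth (G : GaussianMixture) (v : ℝ≥0) (hv : 0 < v) (t : ℝ) :
    (G.smooth v hv t).law = (gaussianReal 0 v).withDensity (priorDensity v t G.law) := by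
  have hd : priorDensity v t G.law
      = ENNReal.ofReal (G.weight 0) • priorDensity v t (gaussianReal (G.mean 0) (G.var 0))
      + ENNReal.ofReal (G.weight 1) • priorDensity v t (gaussianReal (G.mean 1) (G.var 1)) := by
    ext x
    simp only [priorDensity, law_eq, Pi.add_apply, Pi.smul_apply]
    rw [lintegral_add_measure, lintegral_smul_measure, lintegral_smul_measure]
  have hm := fun i => measurable_priorDensity v t (gaussianReal (G.mean i) (G.var i))
  rw [hd, withDensity_add_left ((hm 0).const_smul _), withDensity_smul _ (hm 0),
    withDensity_smul _ (hm 1), ← gaussianReal_add_eq_withDensity t _ _ hv.ne',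
    ← gaussianReal_add_eq_withDensity t _ _ hv.ne', law_eq]
  rfl

lemma variance_smooth (G : GaussianMixture) (v : ℝ≥0) (hv : 0 < v) (t : ℝ) :
    (G.smooth v hv t).variance = v + t ^ 2 * G.variance := by
  have h : G.weight 1 = 1 - G.weight 0 := by linarith [G.weight_sum]
  simp only [variance, smooth, h]
  push_cast
  ring

/-- Smoothings of mixtures with `n` matching moments have a small chi-square divergence. -/
lemma exists_chiSq_le (G G' : GaussianMixture) (n : ℕ)
    (hm : ∀ k < n, ∫ y, y ^ k ∂G.law = ∫ y, y ^ k ∂G'.law) :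
    ∃ w₀ C : ℝ, 0 < w₀ ∧ 0 < C ∧ ∀ (v : ℝ≥0) (hv : 0 < v) (t : ℝ), t ^ 2 / v ≤ w₀ →
      ∃ r : ℝ → ℝ≥0∞, Measurable r ∧ (∀ x, r x ≠ ∞) ∧
        (G.smooth v hv t).law = (G'.smooth v hv t).law.withDensity r ∧
        ∫⁻ x, r x ^ 2 ∂(G'.smooth v hv t).law ≤ ENNReal.ofReal (1 + C * (t ^ 2 / v) ^ n) := by
  obtain ⟨c, hc, hint⟩ := G.exists_integrable_exp_sq_law
  obtain ⟨c', hc', hint'⟩ := G'.exists_integrable_exp_sq_law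
  -- The bound by 1 gives t² ≤ v for `le_priorDensity`; the other two give exponential
  -- integrability.
  set w₀ : ℝ := min 1 (min c c') with hw₀def
  have hw₀ : 0 < w₀ := lt_min one_pos (lt_min hc hc')
  have hw₀1 : w₀ ≤ 1 := min_le_left _ _
  have i1 := hint w₀ ((min_le_right _ _).trans (min_le_left _ _))
  have i2 := hint' w₀ ((min_le_right _ _).trans (min_le_right _ _))
  set A : ℝ := max (max (∫ y, Real.exp (w₀ * y ^ 2) ∂G.law)
    (∫ y, Real.exp (w₀ * y ^ 2) ∂G'.law)) 1 with hA
  have hApos : 0 < A := one_pos.trans_le (le_max_right _ _)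
  -- This lower bound for the density depends on `G'` alone, which keeps the final constant uniform
  -- in v and t.
  set κ : ℝ := (ENNReal.ofReal (Real.exp (-1)) *
    min (G'.law (Set.Icc 0 1)) (G'.law (Set.Icc (-1) 0))).toReal with hκdef
  have hmin : min (G'.law (Set.Icc 0 1)) (G'.law (Set.Icc (-1) 0)) ≠ ∞ :=
    ne_top_of_le_ne_top (measure_ne_top G'.law (Set.Icc 0 1)) (min_le_left _ _)
  have hmin0 : min (G'.law (Set.Icc 0 1)) (G'.law (Set.Icc (-1) 0)) ≠ 0 :=
    (lt_min (G'.law_Icc_pos zero_lt_one) (G'.law_Icc_pos (by norm_num))).ne'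
  have hκtop := ENNReal.mul_ne_top (ENNReal.ofReal_ne_top (r := Real.exp (-1))) hmin
  have hκ : 0 < κ := ENNReal.toReal_pos
    (mul_ne_zero (ENNReal.ofReal_pos.2 (Real.exp_pos _)).ne' hmin0) hκtop
  refine ⟨w₀, 4 * (n.factorial * (1 / w₀) ^ n * A ^ 2) / κ, hw₀, by positivity,
    fun v hv t ht => ?_⟩
  set f := priorDensity v t G.law
  set g := priorDensity v t G'.law
  have hf : Measurable f := measurable_priorDensity _ _ _
  have hg : Measurable g := measurable_priorDensity _ _ _
  have hft : ∀ x, f x ≠ ∞ := fun x => (priorDensity_lt_top hv.ne' t x _).ne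
  have hgt : ∀ x, g x ≠ ∞ := fun x => (priorDensity_lt_top hv.ne' t x _).ne
  have hv' : (0 : ℝ) < v := by exact_mod_cast hv
  have htv : t ^ 2 ≤ v := by
    have := ht.trans hw₀1
    rwa [div_le_one hv'] at this
  have hgκ : ∀ x, ENNReal.ofReal κ ≤ g x := fun x => by
    rw [hκdef, ENNReal.ofReal_toReal hκtop]
    exact le_priorDensity hv.ne' t x _ _ htv (min_le_left _ _) (min_le_right _ _)
  have hg0 : ∀ x, g x ≠ 0 := fun x => ((ENNReal.ofReal_pos.2 hκ).trans_le (hgκ x)).ne'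
  have mass : ∀ H : GaussianMixture, ∫⁻ x, priorDensity v t H.law x ∂gaussianReal 0 v = 1 := by
    intro H
    have h := congrArg (fun μ => μ Set.univ) (H.law_smooth v hv t)
    simp only [measure_univ, withDensity_apply _ MeasurableSet.univ, Measure.restrict_univ] at h
    exact h.symm
  have a1 : ∫ y, Real.exp (w₀ * y ^ 2) ∂G.law ≤ A := (le_max_left _ _).trans (le_max_left _ _)
  have a2 : ∫ y, Real.exp (w₀ * y ^ 2) ∂G'.law ≤ A := (le_max_right _ _).trans (le_max_left _ _)
  have hclose := lintegral_priorDensity_sq_le hv.ne' t hw₀ ht G.law G'.law i1 i2 a1 a2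
    n (fun k _ => G.integrable_pow_law k) (fun k _ => G'.integrable_pow_law k) hm
  have hfg : ∫⁻ x, f x * g x ∂gaussianReal 0 v ≠ ∞ := by
    rw [lintegral_priorDensity_mul hv.ne']
    -- Only integrability is wanted, so order 0 suffices and the moment hypotheses are vacuous.
    have hi := (integrable_exp_mul_prod (by positivity : 0 ≤ t ^ 2 / (v : ℝ)) hw₀ ht G.law G'.law
      i1 i2 a1 a2 0 (by simp) (by simp)).1
    rw [← ofReal_integral_eq_lintegral_ofReal hi (ae_of_all _ fun p => (Real.exp_pos _).le)]
    exact ENNReal.ofReal_ne_top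
  refine ⟨fun x => f x / g x, hf.div hg, fun x => ENNReal.div_ne_top (hft x) (hg0 x), ?_, ?_⟩
  · rw [law_smooth, law_smooth]
    refine Eq.trans ?_ (withDensity_mul (gaussianReal 0 v) hg (hf.div hg))
    congr 1
    ext x
    exact (ENNReal.mul_div_cancel (hg0 x) (hgt x)).symm
  · rw [law_smooth]
    refine (lintegral_ratio_sq_le _ f g hf hg hft hgt κ _ hκ (by positivity) hgκ (mass G) (mass G')
      hfg hclose).trans (le_of_eq ?_)
    congr 2
    rw [one_div, div_eq_mul_inv _ w₀, mul_pow]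
    ring

end GaussianMixture

namespace GaussianMixture

/-! ### Two mixtures with five common moments -/

lemma sqrt_twentyone_bounds : 4.58 < √(21 : ℝ) ∧ √(21 : ℝ) < 4.59 :=
  ⟨Real.lt_sqrt_of_sq_lt (by norm_num), (Real.sqrt_lt' (by norm_num)).2 (by norm_num)⟩

/-- A mixture with irrational parameters and the same first five moments as `priorB`. -/
noncomputable def priorA : GaussianMixture where
  weight := ![1 / 2 - 3 * √21 / 28, 1 / 2 + 3 * √21 / 28]
  mean := ![-9 - 2 * √21, -9 + 2 * √21]
  var := ![(111 - 24 * √21).toNNReal, (111 + 24 * √21).toNNReal]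
  weight_nonneg i := by
    obtain ⟨h1, h2⟩ := sqrt_twentyone_bounds
    fin_cases i <;> norm_num <;> linarith
  weight_sum := by simp; ring
  var_pos i := by
    obtain ⟨h1, h2⟩ := sqrt_twentyone_bounds
    fin_cases i
    · norm_num; linarith
    · norm_num

/-- A mixture with rational parameters and the same first five moments as `priorA`. -/
noncomputable def priorB : GaussianMixture where
  weight := ![3 / 4, 1 / 4]
  mean := ![-3, 9]
  var := ![199, 183]
  weight_nonneg i := by fin_cases i <;> norm_num
  weight_sum := by norm_num
  var_pos i := by fin_cases i <;> norm_num

lemma priorA_var_zero : ((priorA.var 0 : ℝ≥0) : ℝ) = 111 - 24 * √21 := by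
  obtain ⟨h1, h2⟩ := sqrt_twentyone_bounds
  exact Real.coe_toNNReal _ (by linarith)

lemma priorA_var_one : ((priorA.var 1 : ℝ≥0) : ℝ) = 111 + 24 * √21 :=
  Real.coe_toNNReal _ (by positivity)

lemma variance_priorA : priorA.variance = 222 := by
  have hs : √(21 : ℝ) ^ 2 = 21 := Real.sq_sqrt (by norm_num)
  rw [variance, priorA_var_zero, priorA_var_one]
  simp only [priorA, Matrix.cons_val_zero, Matrix.cons_val_one]
  nlinarith

lemma variance_priorB : priorB.variance = 222 := by
  simp [variance, priorB]; norm_num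

/-- A mixture has five free parameters, and five nonlinear moment equations may have several
solutions; these are two, both centred. The components of `priorA` are exchanged by √21 ↦ -√21, so
its moments are rational. -/
lemma moments_priorA_eq_priorB (k : ℕ) (hk : k < 6) :
    ∫ y, y ^ k ∂priorA.law = ∫ y, y ^ k ∂priorB.law := by
  have hs : √(21 : ℝ) ^ 2 = 21 := Real.sq_sqrt (by norm_num)
  have hB0 : ((priorB.var 0 : ℝ≥0) : ℝ) = 199 := by simp [priorB]
  have hB1 : ((priorB.var 1 : ℝ≥0) : ℝ) = 183 := by simp [priorB]
  rw [integral_law _ fun i => integrable_pow_gaussianReal _ _ k,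
    integral_law _ fun i => integrable_pow_gaussianReal _ _ k]
  obtain ⟨a1, a2, a3, a4, a5⟩ := gaussianReal_moments (priorA.mean 0) (priorA.var 0)
  obtain ⟨b1, b2, b3, b4, b5⟩ := gaussianReal_moments (priorA.mean 1) (priorA.var 1)
  obtain ⟨c1, c2, c3, c4, c5⟩ := gaussianReal_moments (priorB.mean 0) (priorB.var 0)
  obtain ⟨d1, d2, d3, d4, d5⟩ := gaussianReal_moments (priorB.mean 1) (priorB.var 1)
  rw [priorA_var_zero] at a2 a3 a4 a5
  rw [priorA_var_one] at b2 b3 b4 b5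
  rw [hB0] at c2 c3 c4 c5
  rw [hB1] at d2 d3 d4 d5
  have w0 : priorA.weight 0 = 1 / 2 - 3 * √21 / 28 := rfl
  have w1 : priorA.weight 1 = 1 / 2 + 3 * √21 / 28 := rfl
  have u0 : priorB.weight 0 = 3 / 4 := rfl
  have u1 : priorB.weight 1 = 1 / 4 := rfl
  have m0 : priorA.mean 0 = -9 - 2 * √21 := rfl
  have m1 : priorA.mean 1 = -9 + 2 * √21 := rfl
  have l0 : priorB.mean 0 = -3 := rfl
  have l1 : priorB.mean 1 = 9 := rfl
  have hs4 : √(21 : ℝ) ^ 4 = 441 := by rw [show (4 : ℕ) = 2 * 2 by rfl, pow_mul, hs]; norm_num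
  have hs6 : √(21 : ℝ) ^ 6 = 9261 := by rw [show (6 : ℕ) = 2 * 3 by rfl, pow_mul, hs]; norm_num
  interval_cases k
  · simp [w0, w1, u0, u1]; norm_num
  · rw [a1, b1, c1, d1, w0, w1, u0, u1, m0, m1, l0, l1]; ring_nf; rw [hs]; norm_num
  · rw [a2, b2, c2, d2, w0, w1, u0, u1, m0, m1, l0, l1]; ring_nf; rw [hs]; norm_num
  · rw [a3, b3, c3, d3, w0, w1, u0, u1, m0, m1, l0, l1]; ring_nf; rw [hs, hs4]; norm_num
  · rw [a4, b4, c4, d4, w0, w1, u0, u1, m0, m1, l0, l1]; ring_nf; rw [hs, hs4]; norm_num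
  · rw [a5, b5, c5, d5, w0, w1, u0, u1, m0, m1, l0, l1]; ring_nf; rw [hs, hs4, hs6]; norm_num

lemma weight_priorA_ge (i : Fin 2) : 1 / 200 ≤ priorA.weight i := by
  obtain ⟨h1, h2⟩ := sqrt_twentyone_bounds
  have h3 : √(21 : ℝ) < 4.583 := (Real.sqrt_lt' (by norm_num)).2 (by norm_num)
  fin_cases i
  · change (1 : ℝ) / 200 ≤ 1 / 2 - 3 * √21 / 28; linarith
  · change (1 : ℝ) / 200 ≤ 1 / 2 + 3 * √21 / 28; linarith

lemma weight_priorB_ge (i : Fin 2) : 1 / 200 ≤ priorB.weight i := by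
  fin_cases i <;> norm_num [priorB]

/-! ### Accuracy -/

/-- A value of one list below all values of the other: no third list is close to both. -/
lemma not_within_both {a b : Fin 2 → ℝ} {r : ℝ} {i : Fin 2} (h : ∀ j, a i + 2 * r < b j)
    (m : Fin 2 → ℝ) (ha : ∃ π : Equiv.Perm (Fin 2), ∀ i, |a i - m (π i)| ≤ r)
    (hb : ∃ π : Equiv.Perm (Fin 2), ∀ i, |b i - m (π i)| ≤ r) : False := by
  obtain ⟨π, hπ⟩ := ha
  obtain ⟨ρ, hρ⟩ := hb
  have h1 := hπ i
  -- The entry of `m` matched to `a i` is also matched to some entry of `b`, which would then lie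
  -- within 2r of `a i`.
  have h2 := hρ (ρ.symm (π i))
  rw [Equiv.apply_symm_apply] at h2
  have h3 := h (ρ.symm (π i))
  rw [abs_le] at h1 h2
  linarith [h1.1, h2.2]

lemma measurableSet_within (a : Fin 2 → ℝ) (r : ℝ) :
    MeasurableSet {m : Fin 2 → ℝ | ∃ π : Equiv.Perm (Fin 2), ∀ i, |a i - m (π i)| ≤ r} := by
  simp only [Set.ofPred_exists, Set.ofPred_forall]
  refine MeasurableSet.iUnion fun π => MeasurableSet.iInter fun i => ?_
  exact measurableSet_le (by fun_prop) measurable_const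

lemma measurableSet_accurate (F : GaussianMixture) (ε : ℝ) :
    MeasurableSet {e : Estimate | e.Accurate F ε} := by
  refine measurableSet_sum_iff.2 ⟨?_, ?_⟩
  · convert measurableSet_within F.mean (ε * √F.variance) using 1
    ext m
    simp [Estimate.Accurate, MeansWithin]
  · convert measurableSet_within (fun i => (F.var i : ℝ)) (ε ^ 2 * F.variance) using 1
    ext m
    simp [Estimate.Accurate, VarsWithin]

/-- Estimates of different kinds are never equal, so it suffices to separate the means and the
variances individually; the separating indices may differ. -/
lemma disjoint_accurate (F F' : GaussianMixture) (ε σ : ℝ) (hσ : 0 ≤ σ)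
    (hF : F.variance = σ ^ 2) (hF' : F'.variance = σ ^ 2) {i k : Fin 2}
    (hmean : ∀ j, F.mean i + 2 * (ε * σ) < F'.mean j)
    (hvar : ∀ j, (F.var k : ℝ) + 2 * (ε ^ 2 * σ ^ 2) < F'.var j) :
    Disjoint {e : Estimate | e.Accurate F ε} {e : Estimate | e.Accurate F' ε} := by
  rw [Set.disjoint_left]
  intro e h h'
  simp only [Set.mem_ofPred_eq, Estimate.Accurate, hF, hF', Real.sqrt_sq hσ] at h h'
  rcases h with ⟨m, rfl, hm⟩ | ⟨s, rfl, hs⟩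
  · rcases h' with ⟨m', he, hm'⟩ | ⟨s', he, hs'⟩
    · cases he
      exact not_within_both hmean m hm hm'
    · cases he
  · rcases h' with ⟨m', he, hm'⟩ | ⟨s', he, hs'⟩
    · cases he
    · cases he
      exact not_within_both (a := fun i => (F.var i : ℝ)) (b := fun i => (F'.var i : ℝ))
        hvar s hs hs'

end GaussianMixture

/-! ### Calibration of the two smoothings and the lower bound -/

theorem mainTheorem4 :
    ∃ p₀ : ℝ, 0 < p₀ ∧ ∃ ε₀ : ℝ, 0 < ε₀ ∧
      ∀ δ₀ : ℝ, 0 < δ₀ → δ₀ < 1 / 2 → ∃ c : ℝ, 0 < c ∧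
        ∀ σ : ℝ, 0 < σ → ∀ ε : ℝ, 0 < ε → ε ≤ ε₀ → ∀ δ : ℝ, 0 < δ → δ ≤ δ₀ →
          ∀ (n : ℕ) (A : ProbabilityTheory.Kernel (Fin n → ℝ) Estimate),
            ProbabilityTheory.IsMarkovKernel A →
            (∀ F : GaussianMixture, F.variance = σ ^ 2 → (∀ i, p₀ ≤ F.weight i) →
              LearnsEither A F ε δ) →
            c * (ε ^ 12)⁻¹ * Real.log (1 / δ) ≤ (n : ℝ) := by
  obtain ⟨w₀, C, hw₀, hC, hχ⟩ := GaussianMixture.exists_chiSq_le GaussianMixture.priorA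
    GaussianMixture.priorB 6 GaussianMixture.moments_priorA_eq_priorB
  -- The smallest weight is 1/2 - 3√21/28 ≈ 0.009. The bound 1/10 on ε gives εσ ≤ 2t, and together
  -- with ε ≤ w₀ it gives ε² ≤ w₀.
  refine ⟨1 / 200, by norm_num, min (1 / 10) w₀, by positivity, fun δ₀ hδ₀ hδ₀' => ?_⟩
  obtain ⟨c, hc, hlog⟩ := exists_mul_log_le hδ₀ hδ₀'
  refine ⟨c / C, by positivity, fun σ hσ ε hε hεε δ hδ hδδ n A hA hlearn => ?_⟩
  have hε10 : ε ≤ 1 / 10 := hεε.trans (min_le_left _ _)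
  have hεw : ε ≤ w₀ := hεε.trans (min_le_right _ _)
  -- Both priors have variance 222, so noise variance q and t² = qε² give total variance q + 222t² =
  -- σ².
  set q : ℝ := σ ^ 2 / (1 + 222 * ε ^ 2) with hq
  have hqpos : 0 < q := by positivity
  set v : ℝ≥0 := q.toNNReal with hv
  have hvq : (v : ℝ) = q := Real.coe_toNNReal _ hqpos.le
  have hvpos : 0 < v := Real.toNNReal_pos.2 hqpos
  set t : ℝ := √q * ε with ht
  have htpos : 0 < t := by positivity
  have ht2 : t ^ 2 = q * ε ^ 2 := by rw [ht, mul_pow, Real.sq_sqrt hqpos.le]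
  have htv : t ^ 2 / v = ε ^ 2 := by rw [ht2, hvq]; field_simp
  have hσq : σ ^ 2 = q + 222 * t ^ 2 := by rw [ht2, hq]; field_simp
  have hεσ : (ε * σ) ^ 2 ≤ (2 * t) ^ 2 := by
    have : ε ^ 2 ≤ (1 / 10) ^ 2 := by gcongr
    rw [mul_pow, hσq, mul_pow 2 t, ht2]
    nlinarith [mul_pos hqpos (pow_pos hε 2)]
  have hεσ' : ε * σ ≤ 2 * t := (sq_le_sq₀ (by positivity) (by positivity)).1 hεσ
  set F := GaussianMixture.priorA.smooth v hvpos t with hF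
  set F' := GaussianMixture.priorB.smooth v hvpos t with hF'
  have hFv : F.variance = σ ^ 2 := by
    rw [hF, GaussianMixture.variance_smooth, GaussianMixture.variance_priorA, hσq, hvq]; ring
  have hFv' : F'.variance = σ ^ 2 := by
    rw [hF', GaussianMixture.variance_smooth, GaussianMixture.variance_priorB, hσq, hvq]; ring
  obtain ⟨s1, s2⟩ := GaussianMixture.sqrt_twentyone_bounds
  have hdisj : Disjoint {e : Estimate | e.Accurate F ε} {e : Estimate | e.Accurate F' ε} := by
    -- Component 0 of `priorA` has mean about -18.2 and variance about 1, against at least -3 and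
    -- 183. The scaled gaps exceed 15t and 181t², while the permitted errors need only 4t and 8t².
    refine GaussianMixture.disjoint_accurate F F' ε σ hσ.le hFv hFv' (i := 0) (k := 0) ?_ ?_
    · have hb : ∀ j, -3 ≤ GaussianMixture.priorB.mean j := fun j => by
        fin_cases j <;> norm_num [GaussianMixture.priorB]
      intro j
      change t * (-9 - 2 * √21) + 2 * (ε * σ) < t * GaussianMixture.priorB.mean j
      nlinarith [mul_le_mul_of_nonneg_left (hb j) htpos.le, mul_lt_mul_of_pos_left s1 htpos]
    · have hb : ∀ j, (183 : ℝ) ≤ GaussianMixture.priorB.var j := fun j => by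
        fin_cases j <;> norm_num [GaussianMixture.priorB]
      intro j
      change (v : ℝ) + t ^ 2 * (GaussianMixture.priorA.var 0 : ℝ) + 2 * (ε ^ 2 * σ ^ 2)
        < (v : ℝ) + t ^ 2 * (GaussianMixture.priorB.var j : ℝ)
      rw [GaussianMixture.priorA_var_zero]
      have ht2' : 0 < t ^ 2 := by positivity
      nlinarith [mul_le_mul_of_nonneg_left (hb j) ht2'.le, mul_lt_mul_of_pos_left s1 ht2']
  have hS := GaussianMixture.measurableSet_accurate F ε
  have hS' := GaussianMixture.measurableSet_accurate F' ε
  have l1 := hlearn F hFv GaussianMixture.weight_priorA_ge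
  have l2 := hlearn F' hFv' GaussianMixture.weight_priorB_ge
  rw [LearnsEither, Measure.bind_apply hS A.measurable.aemeasurable] at l1
  rw [LearnsEither, Measure.bind_apply hS' A.measurable.aemeasurable] at l2
  obtain ⟨r, hr, hrtop, hlaw, hr2⟩ := hχ v hvpos t (by rw [htv]; nlinarith)
  have hδhalf : δ < 1 / 2 := hδδ.trans_lt hδ₀'
  have key := log_le_of_tests F.law F'.law r hr hlaw hrtop (C * (t ^ 2 / v) ^ 6) (by positivity)
    hr2 n (fun x => A x {e | e.Accurate F ε}) (fun x => A x {e | e.Accurate F' ε})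
    (Kernel.measurable_coe A hS) (Kernel.measurable_coe A hS')
    -- The two accuracy events are disjoint, so their probabilities under the kernel sum to at most
    -- one.
    (fun x => by
      rw [← measure_union hdisj hS']
      exact prob_le_one) δ hδ hδhalf l1 l2
  have hfin := (hlog δ hδ hδδ).trans key
  rw [htv, ← pow_mul] at hfin
  have he : 0 < ε ^ 12 := by positivity
  calc c / C * (ε ^ 12)⁻¹ * Real.log (1 / δ)
      = c * Real.log (1 / δ) / (C * ε ^ 12) := by field_simp
    _ ≤ n := by
      rw [div_le_iff₀ (by positivity)]
      exact hfin
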